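/- Let $\mathcal{O}$ be the 16-dimensional real vector space of Hermitian operators (observables) on $\mathbb{C}^2\otimes\mathbb{C}^2$. A separable state is a finite convex combination of product states $\rho_A\otimes\rho_B$, where $\rho_A,\rho_B$ are positive semidefinite $2\times2$ matrices of trace one. The cone of potential witnesses is the set of $W\in\mathcal{O}$ with $\operatorname{Tr}(W\rho)\ge 0$ for every separable state $\rho$. Observables $W$ and $V$ are called LSL-equivalent if $V=M^{-1}W(M^{-1})^\dagger$ for some $M=A\otimes B$ with $A,B\in SL(2,\mathbb{C})$. Let $\sigma=\begin{pmatrix}0&-i\\ i&0\end{pmatrix}$ and $\widetilde W=(\sigma\otimes\sigma)\,W^{t}\,(\sigma\otimes\sigma)$. Let $P_\mu=|\beta_\mu\rangle\langle\beta_\mu|$, $\mu=0,1,2,3$, be the projections onto the Bell states $$\beta_0=\tfrac{1}{\sqrt2}(|00\rangle+|11\rangle),\quad \beta_1=\tfrac{1}{\sqrt2}(|00\rangle-|11\rangle),\quad \beta_2=\tfrac{1}{\sqrt2}(|01\rangle+|10\rangle),\quad \beta_3=\tfrac{1}{i\sqrt2}(|01\rangle-|10\rangle).$$ **Theorem.**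 Let $W$ be an observable in the interior (relative to $\mathcal{O}$) of the cone of potential witnesses. 1. (Existence.) $W$ is LSL-equivalent to a Bell-diagonal observable $\sum_\mu\omega_\mu P_\mu$ with $\omega_0,\dots,\omega_3\in\mathbb{R}$. 2. Whenever $W$ is LSL-equivalent to $\sum_\mu\omega_\mu P_\mu$ with real $\omega_\mu$: - $\sum_\mu\omega_\mu P_\mu$ is itself a potential witness; - the eigenvalues of $\widetilde W W$, counted with algebraic multiplicity, are $\omega_0^2,\omega_1^2,\omega_2^2,\omega_3^2$; - (uniqueness up to tetrahedral symmetry) for $\omega'\in\mathbb{R}^4$, $W$ is LSL-equivalent to $\sum_\mu\omega'_\mu P_\mu$ if and only if $\omega'$ is obtained from $\omega$ by a permutation of its four entries; - at most one of the $\omega_\mu$ is negative, and if $\omega_\mu<0$ then $|\omega_\mu|<|\omega_\nu|$ for all $\nu\ne\mu$. 3. (Canonical order.) There is exactly one $\omega\in\mathbb{R}^4$ with $\omega_0\ge\omega_1\ge\omega_2\ge|\omega_3|$ such that $W$ is LSL-equivalent to $\sum_\mu\omega_\mu P_\mu$. -/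

import Mathlib

open scoped Kronecker ComplexOrder Matrix

/-- Complex matrices acting on the two-qubit space `ℂ² ⊗ ℂ²`; the basis vector `|a⟩ ⊗ |b⟩` has
index `(a, b)`. -/
abbrev TwoQubitMatrix : Type := Matrix (Fin 2 × Fin 2) (Fin 2 × Fin 2) ℂ

/-- Two-qubit observables: the 16-dimensional real vector space of Hermitian matrices, with its
usual topology. -/
abbrev Observable : Type := selfAdjoint TwoQubitMatrix

/-- A one-qubit state: a positive semidefinite `2 × 2` matrix of trace one. -/
def IsQubitState (ρ : Matrix (Fin 2) (Fin 2) ℂ) : Prop :=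
  ρ.PosSemidef ∧ ρ.trace = 1

/-- A normalized two-qubit state is separable if it is a finite convex combination of product
states. -/
def IsSeparableState (ρ : TwoQubitMatrix) : Prop :=
  ∃ (N : ℕ) (p : Fin N → ℝ) (ρA ρB : Fin N → Matrix (Fin 2) (Fin 2) ℂ),
    (∀ n, 0 ≤ p n) ∧ ∑ n, p n = 1 ∧
    (∀ n, IsQubitState (ρA n)) ∧ (∀ n, IsQubitState (ρB n)) ∧
    ρ = ∑ n, (p n : ℂ) • (ρA n ⊗ₖ ρB n)

/-- The cone of potential witnesses: the observables `W` with `Tr (W ρ) ≥ 0` for all separable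
`ρ`. The trace is real, since `W` and `ρ` are Hermitian. -/
def potentialWitnesses : Set Observable :=
  {W | ∀ ρ : TwoQubitMatrix, IsSeparableState ρ → 0 ≤ ((W : TwoQubitMatrix) * ρ).trace.re}

/-- LSL equivalence of observables: `V = W^M = M⁻¹ W (M⁻¹)†` for some `M = A ⊗ B` with
`A, B ∈ SL(2, ℂ)`. -/
def LSLEquiv (W V : Observable) : Prop :=
  ∃ A B : Matrix.SpecialLinearGroup (Fin 2) ℂ,
    (V : TwoQubitMatrix) =
      ((A : Matrix (Fin 2) (Fin 2) ℂ) ⊗ₖ (B : Matrix (Fin 2) (Fin 2) ℂ))⁻¹ * (W : TwoQubitMatrix) *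
        (((A : Matrix (Fin 2) (Fin 2) ℂ) ⊗ₖ (B : Matrix (Fin 2) (Fin 2) ℂ))⁻¹)ᴴ

/-- The antisymmetric Pauli matrix, numbered `σ₃` here. -/
def pauliThree : Matrix (Fin 2) (Fin 2) ℂ :=
  !![0, -Complex.I; Complex.I, 0]

/-- The tilde map (spin flip) `A ↦ (σ₃ ⊗ σ₃) Aᵗ (σ₃ ⊗ σ₃)`. -/
def spinFlip (A : TwoQubitMatrix) : TwoQubitMatrix :=
  (pauliThree ⊗ₖ pauliThree) * Aᵀ * (pauliThree ⊗ₖ pauliThree)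

/-- The computational basis vector `|a⟩ ⊗ |b⟩`. -/
def ket (a b : Fin 2) : Fin 2 × Fin 2 → ℂ :=
  Pi.single (a, b) 1

/-- The Bell states `β₀, β₁, β₂, β₃`; `β₃` is the singlet. -/
noncomputable def bellState : Fin 4 → (Fin 2 × Fin 2 → ℂ) :=
  ![((√2 : ℝ) : ℂ)⁻¹ • (ket 0 0 + ket 1 1),
    ((√2 : ℝ) : ℂ)⁻¹ • (ket 0 0 - ket 1 1),
    ((√2 : ℝ) : ℂ)⁻¹ • (ket 0 1 + ket 1 0),
    (Complex.I * ((√2 : ℝ) : ℂ))⁻¹ • (ket 0 1 - ket 1 0)]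

/-- The Bell projection `P_μ = |β_μ⟩⟨β_μ|`. -/
noncomputable def bellProj (μ : Fin 4) : TwoQubitMatrix :=
  Matrix.vecMulVec (bellState μ) (star (bellState μ))

theorem bellProj_isSelfAdjoint (μ : Fin 4) : IsSelfAdjoint (bellProj μ) := by
  rw [isSelfAdjoint_iff, Matrix.star_eq_conjTranspose, bellProj, Matrix.conjTranspose_vecMulVec,
    star_star]

/-- The Bell-diagonal observable `∑ μ, ω_μ P_μ` with real coefficients. -/
noncomputable def bellDiagonal (ω : Fin 4 → ℝ) : Observable :=
  ∑ μ, ω μ • (⟨bellProj μ, bellProj_isSelfAdjoint μ⟩ : Observable)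

/-! ### LSL equivalence as a group action -/

/-! Existence is variational. Let `D` be a positive combination of product operators, diagonal in
the Bell basis with distinct positive eigenvalues. For `W` interior to the cone, `Tr (W M D M†)` on
`M = A ⊗ B` is bounded below by a multiple of `Tr (A A†) Tr (B B†)`, so it attains its minimum over
determinant-one `A`, `B` (`exists_energy_minimum`). Replacing `W` by `V = M† W M` moves the minimum
to `M = 1`, where the first variation gives `Tr (V N D) = 0` for `N = X ⊗ 1` and `N = 1 ⊗ X` with
`X` traceless. In the Bell basis with suitable phases these `N` span the antisymmetric matrices
(`sl₂ ⊕ sl₂ ≅ so₄`), so `D V` is symmetric: `dᵢ Vᵢⱼ = dⱼ Vⱼᵢ`. Conjugating gives `dᵢ Vⱼᵢ = dⱼ Vᵢⱼ`,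
hence `(dᵢ² - dⱼ²) Vᵢⱼ = 0` and `V` is Bell-diagonal (`eq_bellDiagonal_of_stationary`).

For uniqueness, the characteristic polynomial of `W̃ W` fixes the squares of the coefficients and
the determinant fixes their product. Strict positivity on product vectors makes all pairwise sums of
coefficients positive (`IsProductPositive.add_pos`). So at most one coefficient is negative, and it
is smallest in modulus: squares and product then determine the sorted quadruple. Conversely, local
unitaries realize every permutation (`lslEquiv_bellDiagonal_perm`). -/

theorem SpecialLinearGroup.inv_kronecker_coe (A B : Matrix.SpecialLinearGroup (Fin 2) ℂ) :
    ((A : Matrix (Fin 2) (Fin 2) ℂ) ⊗ₖ (B : Matrix (Fin 2) (Fin 2) ℂ))⁻¹ =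
      ((A⁻¹ : Matrix.SpecialLinearGroup (Fin 2) ℂ) : Matrix (Fin 2) (Fin 2) ℂ) ⊗ₖ
        ((B⁻¹ : Matrix.SpecialLinearGroup (Fin 2) ℂ) : Matrix (Fin 2) (Fin 2) ℂ) := by
  apply Matrix.inv_eq_right_inv
  rw [← Matrix.mul_kronecker_mul, ← Matrix.SpecialLinearGroup.coe_mul,
    ← Matrix.SpecialLinearGroup.coe_mul, mul_inv_cancel, mul_inv_cancel]
  simp

theorem lslEquiv_iff {W V : Observable} :
    LSLEquiv W V ↔ ∃ A B : Matrix (Fin 2) (Fin 2) ℂ, A.det = 1 ∧ B.det = 1 ∧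
      (V : TwoQubitMatrix) = (A ⊗ₖ B) * (W : TwoQubitMatrix) * (A ⊗ₖ B)ᴴ := by
  constructor
  · rintro ⟨A, B, h⟩
    rw [SpecialLinearGroup.inv_kronecker_coe] at h
    exact ⟨_, _, A⁻¹.2, B⁻¹.2, h⟩
  · rintro ⟨A, B, hA, hB, h⟩
    let A' : Matrix.SpecialLinearGroup (Fin 2) ℂ := ⟨A, hA⟩
    let B' : Matrix.SpecialLinearGroup (Fin 2) ℂ := ⟨B, hB⟩
    refine ⟨A'⁻¹, B'⁻¹, ?_⟩
    rw [SpecialLinearGroup.inv_kronecker_coe, inv_inv, inv_inv]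
    exact h

theorem LSLEquiv.refl (W : Observable) : LSLEquiv W W :=
  lslEquiv_iff.2 ⟨1, 1, by simp, by simp, by simp⟩

theorem LSLEquiv.trans {U V W : Observable} (h₁ : LSLEquiv U V) (h₂ : LSLEquiv V W) :
    LSLEquiv U W := by
  obtain ⟨A, B, hA, hB, h⟩ := lslEquiv_iff.1 h₁
  obtain ⟨A', B', hA', hB', h'⟩ := lslEquiv_iff.1 h₂
  refine lslEquiv_iff.2 ⟨A' * A, B' * B, by simp [hA, hA'], by simp [hB, hB'], ?_⟩
  rw [h', h, Matrix.mul_kronecker_mul, Matrix.conjTranspose_mul]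
  simp only [mul_assoc]

theorem LSLEquiv.det_eq {V W : Observable} (h : LSLEquiv W V) :
    (V : TwoQubitMatrix).det = (W : TwoQubitMatrix).det := by
  obtain ⟨A, B, hA, hB, h⟩ := lslEquiv_iff.1 h
  rw [h]
  simp [Matrix.det_kronecker, hA, hB]

theorem kronecker_conj (A B ρ τ : Matrix (Fin 2) (Fin 2) ℂ) :
    (A ⊗ₖ B) * (ρ ⊗ₖ τ) * (A ⊗ₖ B)ᴴ = (A * ρ * Aᴴ) ⊗ₖ (B * τ * Bᴴ) := by
  rw [Matrix.conjTranspose_kronecker, Matrix.mul_kronecker_mul, Matrix.mul_kronecker_mul]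

/-! ### Expectation values on product states -/

/-- The expectation `Tr (W (ρ ⊗ τ))` of an observable on a product operator. -/
noncomputable def productExpectation (W : TwoQubitMatrix) (ρ τ : Matrix (Fin 2) (Fin 2) ℂ) : ℝ :=
  (W * (ρ ⊗ₖ τ)).trace.re

theorem productExpectation_conj (W : TwoQubitMatrix) (A B ρ τ : Matrix (Fin 2) (Fin 2) ℂ) :
    productExpectation ((A ⊗ₖ B) * W * (A ⊗ₖ B)ᴴ) ρ τ =
      productExpectation W (Aᴴ * ρ * A) (Bᴴ * τ * B) := by
  have := kronecker_conj Aᴴ Bᴴ ρ τ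
  simp only [Matrix.conjTranspose_conjTranspose, Matrix.conjTranspose_kronecker] at this
  rw [productExpectation, productExpectation, ← this, mul_assoc, mul_assoc, Matrix.trace_mul_comm,
    Matrix.conjTranspose_kronecker]
  simp only [mul_assoc]

theorem productExpectation_smul (W : TwoQubitMatrix) (r s : ℝ) (ρ τ : Matrix (Fin 2) (Fin 2) ℂ) :
    productExpectation W ((r : ℂ) • ρ) ((s : ℂ) • τ) = r * s * productExpectation W ρ τ := by
  simp only [productExpectation, Matrix.smul_kronecker, Matrix.kronecker_smul, Matrix.mul_smul,
    Matrix.trace_smul, smul_eq_mul, Complex.re_ofReal_mul]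
  ring

theorem Matrix.PosSemidef.exists_qubitState {ρ : Matrix (Fin 2) (Fin 2) ℂ} (h : ρ.PosSemidef)
    (h0 : ρ ≠ 0) : 0 < ρ.trace.re ∧ ∃ σ, IsQubitState σ ∧ ρ = (ρ.trace.re : ℂ) • σ := by
  have h1 : (0 : ℂ) ≤ ρ.trace := h.trace_nonneg
  have h2 : ρ.trace ≠ 0 := fun h3 => h0 (h.trace_eq_zero_iff.1 h3)
  have h3 := lt_of_le_of_ne h1 h2.symm
  rw [Complex.lt_def] at h3
  have h4 : (ρ.trace.re : ℂ) = ρ.trace := by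
    apply Complex.ext <;> simp [← h3.2]
  refine ⟨h3.1, (ρ.trace)⁻¹ • ρ, ⟨h.smul ?_, ?_⟩, ?_⟩
  · rw [← h4, ← Complex.ofReal_inv]
    exact Complex.zero_le_real.2 (inv_nonneg.2 h3.1.le)
  · simp [h2]
  · rw [h4, smul_smul, mul_inv_cancel₀ h2, one_smul]

/-- By linearity, and by rescaling to trace one, positivity need only be tested on product
operators, without normalization. -/
theorem mem_potentialWitnesses_iff {W : Observable} : W ∈ potentialWitnesses ↔
    ∀ ρ τ : Matrix (Fin 2) (Fin 2) ℂ, ρ.PosSemidef → τ.PosSemidef →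
      0 ≤ productExpectation W ρ τ := by
  constructor
  · intro hW ρ τ hρ hτ
    rcases eq_or_ne ρ 0 with rfl | hρ0
    · simp [productExpectation]
    rcases eq_or_ne τ 0 with rfl | hτ0
    · simp [productExpectation]
    obtain ⟨hr, ρ', hρ', e⟩ := hρ.exists_qubitState hρ0
    obtain ⟨hs, τ', hτ', e'⟩ := hτ.exists_qubitState hτ0
    rw [e, e', productExpectation_smul]
    refine mul_nonneg (mul_pos hr hs).le (hW _ ⟨1, fun _ => 1, fun _ => ρ', fun _ => τ', ?_⟩)
    simp [hρ', hτ']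
  · rintro h _ ⟨N, p, ρ, τ, hp, -, hρ, hτ, rfl⟩
    rw [Matrix.mul_sum, Matrix.trace_sum, Complex.re_sum]
    refine Finset.sum_nonneg fun n _ => ?_
    rw [Matrix.mul_smul, Matrix.trace_smul, smul_eq_mul, Complex.re_ofReal_mul]
    exact mul_nonneg (hp n) (h _ _ (hρ n).1 (hτ n).1)

/-- `W - ε • 1` is still a potential witness for small `ε > 0`. This quantitative bound provides
both coercivity of the energy and strict positivity. -/
theorem exists_lower_bound_of_mem_interior {W : Observable} (hW : W ∈ interior potentialWitnesses) :
    ∃ ε : ℝ, 0 < ε ∧ ∀ ρ τ : Matrix (Fin 2) (Fin 2) ℂ, ρ.PosSemidef → τ.PosSemidef →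
      ε * (ρ.trace.re * τ.trace.re) ≤ productExpectation W ρ τ := by
  have hc : Continuous fun t : ℝ => W - t • (1 : Observable) := by
    refine continuous_induced_rng.2 ?_
    simp only [Function.comp_def, AddSubgroupClass.coe_sub, selfAdjoint.val_smul]
    fun_prop
  have h0 : ∀ᶠ t : ℝ in nhds 0, W - t • (1 : Observable) ∈ potentialWitnesses := by
    apply hc.continuousAt.eventually
    simpa using mem_interior_iff_mem_nhds.1 hW
  obtain ⟨ε, hε, h⟩ :=
    ((h0.filter_mono nhdsWithin_le_nhds).and (self_mem_nhdsWithin (s := Set.Ioi (0 : ℝ)))).exists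
  refine ⟨ε, h, fun ρ τ hρ hτ => ?_⟩
  have h1 := mem_potentialWitnesses_iff.1 hε ρ τ hρ hτ
  have i1 : ρ.trace.im = 0 := (Complex.le_def.1 (hρ.trace_nonneg)).2.symm
  simp only [productExpectation, AddSubgroupClass.coe_sub, selfAdjoint.val_smul,
    selfAdjoint.val_one, Matrix.sub_mul, Matrix.smul_mul, one_mul, Matrix.trace_sub,
    Matrix.trace_smul, Matrix.trace_kronecker, Complex.sub_re, Complex.smul_re, Complex.mul_re, i1,
    smul_eq_mul] at h1 ⊢
  linarith

/-- Observables with strictly positive expectation on all nonzero positive product operators. -/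
def IsProductPositive (W : TwoQubitMatrix) : Prop :=
  ∀ ρ τ : Matrix (Fin 2) (Fin 2) ℂ, ρ.PosSemidef → τ.PosSemidef → ρ ≠ 0 → τ ≠ 0 →
    0 < productExpectation W ρ τ

theorem isProductPositive_of_mem_interior {W : Observable}
    (hW : W ∈ interior potentialWitnesses) : IsProductPositive W := by
  obtain ⟨ε, hε, h⟩ := exists_lower_bound_of_mem_interior hW
  intro ρ τ hρ hτ hρ0 hτ0
  exact (mul_pos hε (mul_pos (hρ.exists_qubitState hρ0).1 (hτ.exists_qubitState hτ0).1)).trans_le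
    (h ρ τ hρ hτ)

theorem IsProductPositive.mem_potentialWitnesses {W : Observable} (h : IsProductPositive W) :
    W ∈ potentialWitnesses := by
  refine mem_potentialWitnesses_iff.2 fun ρ τ hρ hτ => ?_
  rcases eq_or_ne ρ 0 with rfl | hρ0
  · simp [productExpectation]
  rcases eq_or_ne τ 0 with rfl | hτ0
  · simp [productExpectation]
  exact (h ρ τ hρ hτ hρ0 hτ0).le

theorem conjTranspose_mul_mul_ne_zero {A ρ : Matrix (Fin 2) (Fin 2) ℂ} (hA : A.det = 1)
    (hρ : ρ ≠ 0) : Aᴴ * ρ * A ≠ 0 := by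
  intro h
  have hu : IsUnit A := (Matrix.isUnit_iff_isUnit_det A).2 (by simp [hA])
  have hu' : IsUnit Aᴴ := (Matrix.isUnit_iff_isUnit_det _).2 (by simp [Matrix.det_conjTranspose, hA])
  rw [hu.mul_left_eq_zero, hu'.mul_right_eq_zero] at h
  exact hρ h

theorem IsProductPositive.of_lslEquiv {V W : Observable} (hW : IsProductPositive W)
    (h : LSLEquiv W V) : IsProductPositive V := by
  obtain ⟨A, B, hA, hB, h⟩ := lslEquiv_iff.1 h
  intro ρ τ hρ hτ hρ0 hτ0
  rw [h, productExpectation_conj]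
  exact hW _ _ (hρ.conjTranspose_mul_mul_same A) (hτ.conjTranspose_mul_mul_same B)
    (conjTranspose_mul_mul_ne_zero hA hρ0) (conjTranspose_mul_mul_ne_zero hB hτ0)

/-! ### The energy functional and its minimum -/

/-- A positive combination of product states that is Bell-diagonal with the four distinct
eigenvalues `4, 2, 3, 1`. -/
noncomputable def bellFrame : TwoQubitMatrix :=
  1 ⊗ₖ 1 + !![1, 0; 0, 0] ⊗ₖ !![1, 0; 0, 0] + !![0, 0; 0, 1] ⊗ₖ !![0, 0; 0, 1] +
    (1 / 2 : ℂ) • (!![1, 1; 1, 1] ⊗ₖ !![1, 1; 1, 1]) +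
    (1 / 2 : ℂ) • (!![1, -1; -1, 1] ⊗ₖ !![1, -1; -1, 1])

/-- The functional `M ↦ Tr (W M D M†)`, where `D` is `bellFrame`. -/
noncomputable def energy (W M : TwoQubitMatrix) : ℝ :=
  (W * (M * bellFrame * Mᴴ)).trace.re

theorem bellFrame_isHermitian : bellFrameᴴ = bellFrame := by
  ext ⟨a, b⟩ ⟨c, d⟩
  fin_cases a <;> fin_cases b <;> fin_cases c <;> fin_cases d <;>
    simp [bellFrame]

theorem energy_kronecker (W : TwoQubitMatrix) (A B : Matrix (Fin 2) (Fin 2) ℂ) :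
    energy W (A ⊗ₖ B) = productExpectation W (A * 1 * Aᴴ) (B * 1 * Bᴴ) +
      productExpectation W (A * !![1, 0; 0, 0] * Aᴴ) (B * !![1, 0; 0, 0] * Bᴴ) +
      productExpectation W (A * !![0, 0; 0, 1] * Aᴴ) (B * !![0, 0; 0, 1] * Bᴴ) +
      (1 / 2) * productExpectation W (A * !![1, 1; 1, 1] * Aᴴ) (B * !![1, 1; 1, 1] * Bᴴ) +
      (1 / 2) * productExpectation W (A * !![1, -1; -1, 1] * Aᴴ) (B * !![1, -1; -1, 1] * Bᴴ) := by
  have e : (1 / 2 : ℂ) = ((1 / 2 : ℝ) : ℂ) := by norm_num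
  simp only [productExpectation, ← kronecker_conj, energy, bellFrame]
  simp only [Matrix.mul_add, Matrix.add_mul, Matrix.mul_smul, Matrix.smul_mul, Matrix.trace_add,
    Matrix.trace_smul, Complex.add_re, smul_eq_mul, e, Complex.re_ofReal_mul]

/-- The frame is a positive combination of product operators; only its `1 ⊗ 1` term is kept, the
others contribute nonnegatively. -/
theorem le_energy_kronecker {W : Observable} (hW : W ∈ potentialWitnesses)
    (A B : Matrix (Fin 2) (Fin 2) ℂ) :
    productExpectation W (A * Aᴴ) (B * Bᴴ) ≤ energy W (A ⊗ₖ B) := by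
  have p0 : (!![1, 0; 0, 0] : Matrix (Fin 2) (Fin 2) ℂ).PosSemidef := by
    convert Matrix.posSemidef_vecMulVec_self_star (R := ℂ) ![1, 0] using 1
    ext i j; fin_cases i <;> fin_cases j <;> simp [Matrix.vecMulVec_apply]
  have p1 : (!![0, 0; 0, 1] : Matrix (Fin 2) (Fin 2) ℂ).PosSemidef := by
    convert Matrix.posSemidef_vecMulVec_self_star (R := ℂ) ![0, 1] using 1
    ext i j; fin_cases i <;> fin_cases j <;> simp [Matrix.vecMulVec_apply]
  have p2 : (!![1, 1; 1, 1] : Matrix (Fin 2) (Fin 2) ℂ).PosSemidef := by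
    convert Matrix.posSemidef_vecMulVec_self_star (R := ℂ) ![1, 1] using 1
    ext i j; fin_cases i <;> fin_cases j <;> simp [Matrix.vecMulVec_apply]
  have p3 : (!![1, -1; -1, 1] : Matrix (Fin 2) (Fin 2) ℂ).PosSemidef := by
    convert Matrix.posSemidef_vecMulVec_self_star (R := ℂ) ![1, -1] using 1
    ext i j; fin_cases i <;> fin_cases j <;> simp [Matrix.vecMulVec_apply]
  have h := fun {P : Matrix (Fin 2) (Fin 2) ℂ} (hP : P.PosSemidef) =>
    mem_potentialWitnesses_iff.1 hW _ _ (hP.mul_mul_conjTranspose_same A)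
      (hP.mul_mul_conjTranspose_same B)
  rw [energy_kronecker, mul_one, mul_one]
  linarith [h p0, h p1, h p2, h p3]

theorem energy_smul (W M : TwoQubitMatrix) (z : ℂ) :
    energy W (z • M) = Complex.normSq z * energy W M := by
  have : W * (z • M * bellFrame * (z • M)ᴴ) =
      ((Complex.normSq z : ℝ) : ℂ) • (W * (M * bellFrame * Mᴴ)) := by
    rw [← Complex.mul_conj]
    simp only [Matrix.conjTranspose_smul, Matrix.smul_mul, Matrix.mul_smul, smul_smul]
    rw [mul_comm]
    rfl
  rw [energy, this, Matrix.trace_smul, smul_eq_mul, Complex.re_ofReal_mul, energy]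

theorem energy_conj (W M N : TwoQubitMatrix) : energy (Mᴴ * W * M) N = energy W (M * N) := by
  simp only [energy, Matrix.conjTranspose_mul, mul_assoc]
  rw [Matrix.trace_mul_comm]
  simp only [mul_assoc]

theorem continuous_energy_kronecker (W : TwoQubitMatrix) :
    Continuous fun p : Matrix (Fin 2) (Fin 2) ℂ × Matrix (Fin 2) (Fin 2) ℂ =>
      energy W (p.1 ⊗ₖ p.2) := by
  have h : Continuous fun p : Matrix (Fin 2) (Fin 2) ℂ × Matrix (Fin 2) (Fin 2) ℂ =>
      p.1 ⊗ₖ p.2 := by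
    refine continuous_matrix fun i j => ?_
    simp only [Matrix.kroneckerMap_apply]
    fun_prop
  unfold energy
  fun_prop

theorem trace_mul_conjTranspose_re (A : Matrix (Fin 2) (Fin 2) ℂ) :
    (A * Aᴴ).trace.re = ∑ i, ∑ j, ‖A i j‖ ^ 2 := by
  simp [Matrix.trace, Matrix.mul_apply, Fin.sum_univ_two, Complex.mul_conj, Complex.sq_norm]

theorem sq_norm_le_trace (A : Matrix (Fin 2) (Fin 2) ℂ) (i j : Fin 2) :
    ‖A i j‖ ^ 2 ≤ (A * Aᴴ).trace.re := by
  rw [trace_mul_conjTranspose_re]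
  simp only [Fin.sum_univ_two]
  have := fun i j => sq_nonneg ‖A i j‖
  fin_cases i <;> fin_cases j <;> simp <;> linarith [this 0 0, this 0 1, this 1 0, this 1 1]

/-- `1 = |ad - bc| ≤ |a||d| + |b||c|`, and AM-GM. In the minimization, a bound on the product of the
two traces thereby bounds each one. -/
theorem one_le_trace_of_det_eq_one {A : Matrix (Fin 2) (Fin 2) ℂ} (h : A.det = 1) :
    1 ≤ (A * Aᴴ).trace.re := by
  rw [trace_mul_conjTranspose_re]
  simp only [Fin.sum_univ_two]
  have h1 : ‖A 0 0 * A 1 1 - A 0 1 * A 1 0‖ = 1 := by rw [← Matrix.det_fin_two, h, norm_one]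
  have h2 := norm_sub_le (A 0 0 * A 1 1) (A 0 1 * A 1 0)
  rw [h1, norm_mul, norm_mul] at h2
  nlinarith [sq_nonneg (‖A 0 0‖ - ‖A 1 1‖), sq_nonneg (‖A 0 1‖ - ‖A 1 0‖),
    sq_nonneg ‖A 0 0‖, sq_nonneg ‖A 0 1‖, sq_nonneg ‖A 1 0‖, sq_nonneg ‖A 1 1‖]

theorem isCompact_matrix_norm_le (R : ℝ) :
    IsCompact {A : Matrix (Fin 2) (Fin 2) ℂ | ∀ i j, ‖A i j‖ ≤ R} := by
  have : IsCompact (Set.pi Set.univ fun _ : Fin 2 =>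
      Set.pi Set.univ fun _ : Fin 2 => Metric.closedBall (0 : ℂ) R) :=
    isCompact_univ_pi fun _ => isCompact_univ_pi fun _ => isCompact_closedBall 0 R
  have e : (Set.pi Set.univ fun _ : Fin 2 =>
      Set.pi Set.univ fun _ : Fin 2 => Metric.closedBall (0 : ℂ) R) =
      {A | ∀ i j, ‖A i j‖ ≤ R} := by
    ext A
    simp [Set.mem_pi]
  rw [e] at this
  exact this

theorem exists_energy_minimum {W : Observable} (hW : W ∈ interior potentialWitnesses) :
    ∃ A B : Matrix (Fin 2) (Fin 2) ℂ, A.det = 1 ∧ B.det = 1 ∧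
      ∀ A' B' : Matrix (Fin 2) (Fin 2) ℂ, A'.det = 1 → B'.det = 1 →
        energy W (A ⊗ₖ B) ≤ energy W (A' ⊗ₖ B') := by
  obtain ⟨ε, hε, hlow⟩ := exists_lower_bound_of_mem_interior hW
  have hlow' : ∀ A B : Matrix (Fin 2) (Fin 2) ℂ,
      ε * ((A * Aᴴ).trace.re * (B * Bᴴ).trace.re) ≤ energy W (A ⊗ₖ B) := fun A B =>
    (hlow _ _ (Matrix.posSemidef_self_mul_conjTranspose A)
      (Matrix.posSemidef_self_mul_conjTranspose B)).trans
      (le_energy_kronecker (interior_subset hW) A B)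
  set e₀ := energy W (1 ⊗ₖ 1) with he₀
  -- Each entry satisfies `‖a‖² ≤ e₀ / ε`, and `2‖a‖ ≤ ‖a‖² + 1` turns this into `‖a‖ ≤ R`.
  set R : ℝ := e₀ / ε + 1
  have hR : ∀ A B : Matrix (Fin 2) (Fin 2) ℂ, A.det = 1 → B.det = 1 →
      energy W (A ⊗ₖ B) ≤ e₀ → (∀ i j, ‖A i j‖ ≤ R) ∧ ∀ i j, ‖B i j‖ ≤ R := by
    intro A B hA hB h
    have h1 := (hlow' A B).trans h
    rw [mul_comm, ← le_div_iff₀ hε] at h1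
    have h2 := one_le_trace_of_det_eq_one hA
    have h3 := one_le_trace_of_det_eq_one hB
    have h4 : (A * Aᴴ).trace.re ≤ e₀ / ε := by nlinarith
    have h5 : (B * Bᴴ).trace.re ≤ e₀ / ε := by nlinarith
    constructor <;> intro i j
    · nlinarith [sq_norm_le_trace A i j, sq_nonneg (‖A i j‖ - 1), norm_nonneg (A i j)]
    · nlinarith [sq_norm_le_trace B i j, sq_nonneg (‖B i j‖ - 1), norm_nonneg (B i j)]
  let K : Set (Matrix (Fin 2) (Fin 2) ℂ × Matrix (Fin 2) (Fin 2) ℂ) :=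
    ({A | ∀ i j, ‖A i j‖ ≤ R} ×ˢ {A | ∀ i j, ‖A i j‖ ≤ R}) ∩ {p | p.1.det = 1 ∧ p.2.det = 1}
  have hK : IsCompact K := by
    refine ((isCompact_matrix_norm_le R).prod (isCompact_matrix_norm_le R)).inter_right ?_
    refine IsClosed.inter (isClosed_eq ?_ continuous_const) (isClosed_eq ?_ continuous_const)
    · exact continuous_fst.matrix_det
    · exact continuous_snd.matrix_det
  have h1K : ((1, 1) : Matrix (Fin 2) (Fin 2) ℂ × Matrix (Fin 2) (Fin 2) ℂ) ∈ K :=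
    ⟨hR 1 1 (by simp) (by simp) le_rfl, by simp, by simp⟩
  obtain ⟨⟨A, B⟩, ⟨-, hA, hB⟩, hmin⟩ :=
    hK.exists_isMinOn ⟨_, h1K⟩ (continuous_energy_kronecker W).continuousOn
  refine ⟨A, B, hA, hB, fun A' B' hA' hB' => ?_⟩
  rcases le_total (energy W (A' ⊗ₖ B')) e₀ with h | h
  · exact isMinOn_iff.1 hmin (A', B') ⟨hR A' B' hA' hB' h, hA', hB'⟩
  · exact (isMinOn_iff.1 hmin (1, 1) h1K).trans h

/-! ### The stationarity condition -/

theorem energy_variation {W : TwoQubitMatrix} (hW : Wᴴ = W) (N : TwoQubitMatrix) (z : ℂ) :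
    energy W (1 + z • N) = energy W 1 + 2 * (z * (W * (N * bellFrame)).trace).re +
      Complex.normSq z * energy W N := by
  have h : (W * (bellFrame * Nᴴ)).trace = star (W * (N * bellFrame)).trace := by
    rw [← Matrix.trace_conjTranspose, Matrix.conjTranspose_mul, Matrix.conjTranspose_mul,
      bellFrame_isHermitian, hW, Matrix.trace_mul_comm]
  have h' : (star z * star (W * (N * bellFrame)).trace).re = (z * (W * (N * bellFrame)).trace).re := by
    rw [← star_mul', Complex.star_def, Complex.conj_re]
  rw [← energy_smul]
  simp only [energy, Matrix.conjTranspose_add, Matrix.conjTranspose_one, one_mul, mul_one,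
    Matrix.conjTranspose_smul, Matrix.add_mul, Matrix.trace_add, Matrix.smul_mul,
    Matrix.mul_smul, Matrix.trace_smul, h, smul_eq_mul, mul_add, Complex.add_re, h']
  ring

theorem eq_zero_of_forall_quadratic_nonneg {c : ℂ} {K L : ℝ}
    (h : ∀ z : ℂ, K * Complex.normSq z < 1 → 0 ≤ 2 * (z * c).re + L * Complex.normSq z) :
    c = 0 := by
  by_contra hc
  have hn : 0 < Complex.normSq c := Complex.normSq_pos.2 hc
  set n := Complex.normSq c
  -- The test point is `z = -c̄ / s`: the linear term is `-2n/s`, while `s` is large enough that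
  -- `K|z|² < 1` and that the quadratic term is at most `n/s`.
  set s : ℝ := 1 + |K| * n + |L|
  have hs : 1 ≤ s := by have := abs_nonneg K; have := abs_nonneg L; simp only [s]; nlinarith
  have hs0 : 0 < s := by linarith
  have e1 : Complex.normSq (-((s⁻¹ : ℝ) : ℂ) * star c) = s⁻¹ ^ 2 * n := by
    rw [Complex.normSq_mul, Complex.normSq_neg, Complex.normSq_ofReal, Complex.star_def,
      Complex.normSq_conj]
    ring
  have e2 : (-((s⁻¹ : ℝ) : ℂ) * star c * c).re = -(s⁻¹ * n) := by
    rw [mul_assoc, mul_comm (star c), Complex.star_def, Complex.mul_conj, ← Complex.ofReal_neg,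
      ← Complex.ofReal_mul, Complex.ofReal_re]
    ring
  have hi : s⁻¹ ≤ 1 := inv_le_one_of_one_le₀ hs
  have hi0 : 0 < s⁻¹ := inv_pos.2 hs0
  have hsi : s⁻¹ * s = 1 := inv_mul_cancel₀ hs0.ne'
  have hK : s⁻¹ * (|K| * n) < 1 := by
    rw [← hsi]; exact mul_lt_mul_of_pos_left (by simp only [s]; linarith [abs_nonneg L]) hi0
  have hL : s⁻¹ * |L| < 1 := by
    rw [← hsi]
    exact mul_lt_mul_of_pos_left
      (by simp only [s]; linarith [mul_nonneg (abs_nonneg K) hn.le]) hi0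
  have h1 := h (-((s⁻¹ : ℝ) : ℂ) * star c) (by
    rw [e1]
    have : K * (s⁻¹ ^ 2 * n) ≤ s⁻¹ * (s⁻¹ * (|K| * n)) := by
      nlinarith [le_abs_self K, mul_pos (mul_pos hi0 hi0) hn]
    nlinarith)
  rw [e1, e2] at h1
  have h2 : s⁻¹ * L ≤ s⁻¹ * |L| := mul_le_mul_of_nonneg_left (le_abs_self L) hi0.le
  nlinarith [mul_pos hi0 hn]

/-- The factor `‖1 + z² k‖` comes from rescaling `1 + z • N` to determinant one, with `k = det X`.
It differs from `1` only to second order, so the linear term must vanish; letting `z` be complex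
kills the whole trace, not just its real part. -/
theorem trace_eq_zero_of_energy_bound {W : TwoQubitMatrix} (hW : Wᴴ = W) {N : TwoQubitMatrix}
    {k : ℂ} (h : ∀ z : ℂ, 1 + z ^ 2 * k ≠ 0 → ‖1 + z ^ 2 * k‖ * energy W 1 ≤ energy W (1 + z • N)) :
    (W * (N * bellFrame)).trace = 0 := by
  refine eq_zero_of_forall_quadratic_nonneg (K := ‖k‖) (L := energy W N + ‖k‖ * |energy W 1|)
    fun z hz => ?_
  have h0 : ‖z ^ 2 * k‖ = ‖k‖ * Complex.normSq z := by
    rw [norm_mul, norm_pow, Complex.sq_norm, mul_comm]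
  have h1 := abs_le.1 ((abs_norm_sub_norm_le (1 + z ^ 2 * k) 1).trans_eq
    (by rw [add_sub_cancel_left, h0]))
  rw [norm_one] at h1
  have h2 : 1 + z ^ 2 * k ≠ 0 := by
    intro h3
    rw [h3, norm_zero] at h1
    linarith
  have h3 := h z h2
  rw [energy_variation hW] at h3
  have h4 : |(‖1 + z ^ 2 * k‖ - 1) * energy W 1| ≤ ‖k‖ * Complex.normSq z * |energy W 1| := by
    rw [abs_mul]
    exact mul_le_mul_of_nonneg_right (abs_le.2 h1) (abs_nonneg _)
  have h5 := (abs_le.1 h4).1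
  linarith

theorem exists_smul_det_eq_one {A : Matrix (Fin 2) (Fin 2) ℂ} (hA : A.det ≠ 0) :
    ∃ (s : ℂ) (A' : Matrix (Fin 2) (Fin 2) ℂ), A'.det = 1 ∧ A = s • A' ∧
      Complex.normSq s = ‖A.det‖ := by
  obtain ⟨s, hs⟩ := IsAlgClosed.exists_pow_nat_eq A.det (n := 2) (by norm_num)
  have hs0 : s ≠ 0 := by
    rintro rfl
    exact hA (by rw [← hs]; simp)
  refine ⟨s, s⁻¹ • A, ?_, ?_, ?_⟩
  · rw [Matrix.det_smul, ← hs, Fintype.card_fin, ← mul_pow, inv_mul_cancel₀ hs0, one_pow]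
  · rw [smul_smul, mul_inv_cancel₀ hs0, one_smul]
  · rw [← hs, norm_pow, Complex.sq_norm]

theorem det_one_add_smul {X : Matrix (Fin 2) (Fin 2) ℂ} (hX : X.trace = 0) (z : ℂ) :
    (1 + z • X).det = 1 + z ^ 2 * X.det := by
  rw [Matrix.trace_fin_two] at hX
  simp [Matrix.det_fin_two]
  linear_combination z * hX

theorem stationary_left {W : TwoQubitMatrix} (hW : Wᴴ = W)
    (hmin : ∀ A B : Matrix (Fin 2) (Fin 2) ℂ, A.det = 1 → B.det = 1 →
      energy W 1 ≤ energy W (A ⊗ₖ B)) {X : Matrix (Fin 2) (Fin 2) ℂ} (hX : X.trace = 0) :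
    (W * ((X ⊗ₖ 1) * bellFrame)).trace = 0 := by
  refine trace_eq_zero_of_energy_bound hW (k := X.det) fun z hz => ?_
  rw [← det_one_add_smul hX] at hz ⊢
  obtain ⟨s, A, hA, e, hs⟩ := exists_smul_det_eq_one hz
  have : (1 : TwoQubitMatrix) + z • (X ⊗ₖ 1) = s • (A ⊗ₖ 1) := by
    rw [← Matrix.smul_kronecker s, ← e, Matrix.add_kronecker, Matrix.smul_kronecker,
      Matrix.one_kronecker_one]
  rw [this, energy_smul, ← hs]
  exact mul_le_mul_of_nonneg_left (hmin _ _ hA (by simp)) (Complex.normSq_nonneg _)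

theorem stationary_right {W : TwoQubitMatrix} (hW : Wᴴ = W)
    (hmin : ∀ A B : Matrix (Fin 2) (Fin 2) ℂ, A.det = 1 → B.det = 1 →
      energy W 1 ≤ energy W (A ⊗ₖ B)) {X : Matrix (Fin 2) (Fin 2) ℂ} (hX : X.trace = 0) :
    (W * ((1 ⊗ₖ X) * bellFrame)).trace = 0 := by
  refine trace_eq_zero_of_energy_bound hW (k := X.det) fun z hz => ?_
  rw [← det_one_add_smul hX] at hz ⊢
  obtain ⟨s, A, hA, e, hs⟩ := exists_smul_det_eq_one hz
  have : (1 : TwoQubitMatrix) + z • (1 ⊗ₖ X) = s • (1 ⊗ₖ A) := by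
    rw [← Matrix.kronecker_smul s, ← e, Matrix.kronecker_add, Matrix.kronecker_smul,
      Matrix.one_kronecker_one]
  rw [this, energy_smul, ← hs]
  exact mul_le_mul_of_nonneg_left (hmin _ _ (by simp) hA) (Complex.normSq_nonneg _)

/-! ### Bell-diagonal observables in the computational basis -/

theorem bellDiagonal_coe (ω : Fin 4 → ℝ) :
    (bellDiagonal ω : TwoQubitMatrix) = ∑ μ, (ω μ : ℂ) • bellProj μ := by
  simp [bellDiagonal]

theorem inv_sqrt_two_mul_self : ((√2 : ℝ) : ℂ)⁻¹ * ((√2 : ℝ) : ℂ)⁻¹ = 1 / 2 := by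
  rw [← mul_inv, ← Complex.ofReal_mul, Real.mul_self_sqrt (by norm_num)]
  norm_num

theorem bellDiagonal_eq (ω : Fin 4 → ℝ) : (bellDiagonal ω : TwoQubitMatrix) =
    Matrix.of fun i j =>
      if i.1 = i.2 then
        if j.1 = j.2 then (if i.1 = j.1 then ((ω 0 : ℂ) + ω 1) / 2 else ((ω 0 : ℂ) - ω 1) / 2)
        else 0
      else
        if j.1 = j.2 then 0
        else (if i.1 = j.1 then ((ω 2 : ℂ) + ω 3) / 2 else ((ω 2 : ℂ) - ω 3) / 2) := by
  rw [bellDiagonal_coe]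
  have h := inv_sqrt_two_mul_self
  ext ⟨a, b⟩ ⟨c, d⟩
  fin_cases a <;> fin_cases b <;> fin_cases c <;> fin_cases d <;>
    simp [Fin.sum_univ_four, bellProj, bellState, ket, Matrix.vecMulVec_apply, Matrix.add_apply] <;>
    grind [Complex.I_sq]

/-- With `s² = i`, the local unitary multiplies `|00⟩` by `i` and `|11⟩` by `-i`, exchanging `β₀`
and `β₁` up to phase, and fixes `|01⟩` and `|10⟩`. -/
theorem lslEquiv_swap_zero_one (ω : Fin 4 → ℝ) :
    LSLEquiv (bellDiagonal ω) (bellDiagonal (ω ∘ Equiv.swap 0 1)) := by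
  obtain ⟨s, hs⟩ := IsAlgClosed.exists_pow_nat_eq Complex.I (n := 2) (by norm_num)
  have hn : s * star s = 1 := by
    have : ‖s‖ ^ 2 = 1 := by rw [← norm_pow, hs, Complex.norm_I]
    rw [Complex.star_def, Complex.mul_conj, ← Complex.sq_norm, this, Complex.ofReal_one]
  rw [Complex.star_def] at hn
  have hs' : (starRingEnd ℂ s) ^ 2 = -Complex.I := by rw [← map_pow, hs, Complex.conj_I]
  refine lslEquiv_iff.2 ⟨!![s, 0; 0, star s], !![s, 0; 0, star s], by simp [hn], by simp [hn], ?_⟩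
  rw [bellDiagonal_eq, bellDiagonal_eq]
  ext ⟨a, b⟩ ⟨c, d⟩
  fin_cases a <;> fin_cases b <;> fin_cases c <;> fin_cases d <;>
    simp [Matrix.mul_apply, Fintype.sum_prod_type, Equiv.swap_apply_def] <;>
    grind [Complex.I_sq]

/-- A Hadamard gate on each qubit exchanges `β₁` and `β₂`; the factor `i` corrects its determinant
from `-1` to `1`. -/
theorem lslEquiv_swap_one_two (ω : Fin 4 → ℝ) :
    LSLEquiv (bellDiagonal ω) (bellDiagonal (ω ∘ Equiv.swap 1 2)) := by
  have h := inv_sqrt_two_mul_self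
  set s : ℂ := ((√2 : ℝ) : ℂ)⁻¹ with hs
  have hc : starRingEnd ℂ s = s := by rw [hs, map_inv₀, Complex.conj_ofReal]
  refine lslEquiv_iff.2 ⟨(Complex.I * s) • !![1, 1; 1, -1], (Complex.I * s) • !![1, 1; 1, -1],
    ?_, ?_, ?_⟩
  · simp [Matrix.det_fin_two]; grind [Complex.I_sq]
  · simp [Matrix.det_fin_two]; grind [Complex.I_sq]
  rw [bellDiagonal_eq, bellDiagonal_eq]
  ext ⟨a, b⟩ ⟨c, d⟩
  fin_cases a <;> fin_cases b <;> fin_cases c <;> fin_cases d <;>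
    simp [Matrix.mul_apply, Fintype.sum_prod_type, Equiv.swap_apply_def, hc] <;>
    grind [Complex.I_sq]

/-- Inverting the phases on the second qubit makes the unitary act on `|01⟩`, `|10⟩` by `i`, `-i`
and fix `|00⟩`, `|11⟩`. -/
theorem lslEquiv_swap_two_three (ω : Fin 4 → ℝ) :
    LSLEquiv (bellDiagonal ω) (bellDiagonal (ω ∘ Equiv.swap 2 3)) := by
  obtain ⟨s, hs⟩ := IsAlgClosed.exists_pow_nat_eq Complex.I (n := 2) (by norm_num)
  have hn : s * star s = 1 := by
    have : ‖s‖ ^ 2 = 1 := by rw [← norm_pow, hs, Complex.norm_I]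
    rw [Complex.star_def, Complex.mul_conj, ← Complex.sq_norm, this, Complex.ofReal_one]
  rw [Complex.star_def] at hn
  have hs' : (starRingEnd ℂ s) ^ 2 = -Complex.I := by rw [← map_pow, hs, Complex.conj_I]
  refine lslEquiv_iff.2 ⟨!![s, 0; 0, star s], !![star s, 0; 0, s], by simp [hn],
    by simp [mul_comm, hn], ?_⟩
  rw [bellDiagonal_eq, bellDiagonal_eq]
  ext ⟨a, b⟩ ⟨c, d⟩
  fin_cases a <;> fin_cases b <;> fin_cases c <;> fin_cases d <;>
    simp [Matrix.mul_apply, Fintype.sum_prod_type, Equiv.swap_apply_def] <;>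
    grind [Complex.I_sq]

theorem lslEquiv_bellDiagonal_perm (ω : Fin 4 → ℝ) (π : Equiv.Perm (Fin 4)) :
    LSLEquiv (bellDiagonal ω) (bellDiagonal (ω ∘ π)) := by
  have h : π ∈ Submonoid.closure
      (Set.range fun i : Fin 3 => Equiv.swap i.castSucc i.succ) := by
    rw [Equiv.Perm.mclosure_swap_castSucc_succ]; trivial
  induction h using Submonoid.closure_induction generalizing ω with
  | mem x hx =>
    obtain ⟨i, rfl⟩ := hx
    fin_cases i
    · exact lslEquiv_swap_zero_one ω
    · exact lslEquiv_swap_one_two ω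
    · exact lslEquiv_swap_two_three ω
  | one => exact LSLEquiv.refl _
  | mul x y _ _ hx hy => exact (hx ω).trans (hy (ω ∘ x))

theorem eq_bellDiagonal_of_stationary {W : TwoQubitMatrix} (hW : Wᴴ = W)
    (hl : ∀ X : Matrix (Fin 2) (Fin 2) ℂ, X.trace = 0 → (W * ((X ⊗ₖ 1) * bellFrame)).trace = 0)
    (hr : ∀ X : Matrix (Fin 2) (Fin 2) ℂ, X.trace = 0 → (W * ((1 ⊗ₖ X) * bellFrame)).trace = 0) :
    ∃ ω : Fin 4 → ℝ, (bellDiagonal ω : TwoQubitMatrix) = W := by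
  have star_eq : ∀ i j, starRingEnd ℂ (W i j) = W j i := fun i j => by
    conv_rhs => rw [← hW]
    rfl
  have l0 := hl !![1, 0; 0, -1] (by simp)
  have l1 := hl !![0, 1; 0, 0] (by simp)
  have l2 := hl !![0, 0; 1, 0] (by simp)
  have r0 := hr !![1, 0; 0, -1] (by simp)
  have r1 := hr !![0, 1; 0, 0] (by simp)
  have r2 := hr !![0, 0; 1, 0] (by simp)
  simp [Matrix.trace, Matrix.mul_apply, Fintype.sum_prod_type, bellFrame, Matrix.one_apply]
    at l0 l1 l2 r0 r1 r2
  -- Since `W` is Hermitian, the conjugate equations are again linear in the entries of `W`;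
  -- together the two sets force the Bell-diagonal pattern.
  have l0' := congrArg (starRingEnd ℂ) l0
  have l1' := congrArg (starRingEnd ℂ) l1
  have l2' := congrArg (starRingEnd ℂ) l2
  have r0' := congrArg (starRingEnd ℂ) r0
  have r1' := congrArg (starRingEnd ℂ) r1
  have r2' := congrArg (starRingEnd ℂ) r2
  simp only [map_add, map_mul, map_neg, map_inv₀, map_one, map_zero, map_ofNat, star_eq]
    at l0' l1' l2' r0' r1' r2'
  clear hl hr
  have e1 : W (0, 0) (1, 1) = W (1, 1) (0, 0) := by clear star_eq hW; grind
  have e2 : W (0, 1) (1, 0) = W (1, 0) (0, 1) := by clear star_eq hW; grind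
  have e3 : W (0, 0) (0, 0) = W (1, 1) (1, 1) := by clear star_eq hW; grind
  have e4 : W (0, 1) (0, 1) = W (1, 0) (1, 0) := by clear star_eq hW; grind
  have z1 : W (0, 0) (0, 1) = 0 := by clear star_eq hW; grind
  have z2 : W (0, 0) (1, 0) = 0 := by clear star_eq hW; grind
  have z3 : W (0, 1) (1, 1) = 0 := by clear star_eq hW; grind
  have z4 : W (1, 0) (1, 1) = 0 := by clear star_eq hW; grind
  have z1' : W (0, 1) (0, 0) = 0 := by clear star_eq hW; grind
  have z2' : W (1, 0) (0, 0) = 0 := by clear star_eq hW; grind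
  have z3' : W (1, 1) (0, 1) = 0 := by clear star_eq hW; grind
  have z4' : W (1, 1) (1, 0) = 0 := by clear star_eq hW; grind
  have real_of : ∀ i j, W i j = W j i → ((W i j).re : ℂ) = W i j := fun i j h =>
    Complex.conj_eq_iff_re.1 ((star_eq i j).trans h.symm)
  refine ⟨![(W (0, 0) (0, 0)).re + (W (0, 0) (1, 1)).re,
    (W (0, 0) (0, 0)).re - (W (0, 0) (1, 1)).re,
    (W (0, 1) (0, 1)).re + (W (0, 1) (1, 0)).re,
    (W (0, 1) (0, 1)).re - (W (0, 1) (1, 0)).re], ?_⟩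
  rw [bellDiagonal_eq]
  have c1 := real_of (0, 0) (0, 0) rfl
  have c2 := real_of (0, 0) (1, 1) e1
  have c3 := real_of (0, 1) (0, 1) rfl
  have c4 := real_of (0, 1) (1, 0) e2
  ext ⟨a, b⟩ ⟨c, d⟩
  fin_cases a <;> fin_cases b <;> fin_cases c <;> fin_cases d <;>
    simp [z1, z2, z3, z4, z1', z2', z3', z4', c1, c2, c3, c4] <;> grind

theorem exists_lslEquiv_bellDiagonal {W : Observable} (hW : W ∈ interior potentialWitnesses) :
    ∃ ω : Fin 4 → ℝ, LSLEquiv W (bellDiagonal ω) := by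
  obtain ⟨A, B, hA, hB, hmin⟩ := exists_energy_minimum hW
  -- The adjoint stands on the left, so the equivalence from `W` to `V` is realized by `Aᴴ` and
  -- `Bᴴ`.
  set V : TwoQubitMatrix := (A ⊗ₖ B)ᴴ * W * (A ⊗ₖ B) with hV
  have hVs : Vᴴ = V := by
    have h : (W : TwoQubitMatrix)ᴴ = W := W.2
    rw [hV, Matrix.conjTranspose_mul, Matrix.conjTranspose_mul, h,
      Matrix.conjTranspose_conjTranspose, mul_assoc]
  have hmin' : ∀ A' B' : Matrix (Fin 2) (Fin 2) ℂ, A'.det = 1 → B'.det = 1 →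
      energy V 1 ≤ energy V (A' ⊗ₖ B') := fun A' B' hA' hB' => by
    rw [hV, energy_conj, energy_conj, mul_one, ← Matrix.mul_kronecker_mul]
    exact hmin _ _ (by simp [hA, hA']) (by simp [hB, hB'])
  obtain ⟨ω, hω⟩ := eq_bellDiagonal_of_stationary hVs (fun _ => stationary_left hVs hmin')
    (fun _ => stationary_right hVs hmin')
  refine ⟨ω, lslEquiv_iff.2 ⟨Aᴴ, Bᴴ, by simp [Matrix.det_conjTranspose, hA],
    by simp [Matrix.det_conjTranspose, hB], ?_⟩⟩
  rw [hω, hV, ← Matrix.conjTranspose_kronecker, Matrix.conjTranspose_conjTranspose]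

/-! ### Invariants -/

/-- The matrix whose columns are the Bell states. -/
noncomputable def bellMatrix : Matrix (Fin 2 × Fin 2) (Fin 4) ℂ :=
  Matrix.of fun i μ => bellState μ i

theorem bellMatrix_conjTranspose_mul_self : bellMatrixᴴ * bellMatrix = 1 := by
  have h := inv_sqrt_two_mul_self
  ext μ ν
  fin_cases μ <;> fin_cases ν <;>
    simp [Matrix.mul_apply, bellMatrix, Fintype.sum_prod_type, bellState, ket] <;>
    grind [Complex.I_sq]

theorem bellDiagonal_eq_conj_diagonal (ω : Fin 4 → ℝ) : (bellDiagonal ω : TwoQubitMatrix) =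
    bellMatrix * (Matrix.diagonal fun μ => (ω μ : ℂ)) * bellMatrixᴴ := by
  rw [bellDiagonal_coe]
  ext i j
  rw [Matrix.mul_apply, Matrix.sum_apply]
  refine Finset.sum_congr rfl fun μ _ => ?_
  rw [Matrix.mul_diagonal]
  simp only [Matrix.smul_apply, bellProj, Matrix.vecMulVec_apply, Pi.star_apply, bellMatrix,
    Matrix.of_apply, Matrix.conjTranspose_apply, smul_eq_mul]
  ring

theorem charpoly_conj_bellMatrix (d : Fin 4 → ℂ) :
    (bellMatrix * Matrix.diagonal d * bellMatrixᴴ).charpoly =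
      ∏ μ, (Polynomial.X - Polynomial.C (d μ)) := by
  -- `bellMatrix` has different row and column index types, so the commutation rule for rectangular
  -- factors is used.
  rw [Matrix.mul_assoc, Matrix.charpoly_mul_comm_of_le _ _ (by simp), Matrix.mul_assoc,
    bellMatrix_conjTranspose_mul_self, Matrix.mul_one, Matrix.charpoly_diagonal]
  simp

theorem det_bellDiagonal (ω : Fin 4 → ℝ) :
    (bellDiagonal ω : TwoQubitMatrix).det = ((∏ μ, ω μ : ℝ) : ℂ) := by
  rw [Matrix.det_eq_sign_charpoly_coeff, bellDiagonal_eq_conj_diagonal, charpoly_conj_bellMatrix,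
    Polynomial.coeff_zero_eq_eval_zero, Polynomial.eval_prod]
  norm_num [Fin.prod_univ_four]

theorem spinFlip_bellDiagonal (ω : Fin 4 → ℝ) :
    spinFlip (bellDiagonal ω) = (bellDiagonal ω : TwoQubitMatrix) := by
  rw [bellDiagonal_eq]
  ext ⟨a, b⟩ ⟨c, d⟩
  fin_cases a <;> fin_cases b <;> fin_cases c <;> fin_cases d <;>
    simp [spinFlip, pauliThree, Matrix.mul_apply, Fintype.sum_prod_type]

theorem roots_charpoly_bellDiagonal_sq (ω : Fin 4 → ℝ) :
    ((bellDiagonal ω : TwoQubitMatrix) * (bellDiagonal ω : TwoQubitMatrix)).charpoly.roots =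
      Finset.univ.val.map (fun μ : Fin 4 => ((ω μ ^ 2 : ℝ) : ℂ)) := by
  have : (bellDiagonal ω : TwoQubitMatrix) * (bellDiagonal ω : TwoQubitMatrix) =
      bellMatrix * (Matrix.diagonal fun μ => ((ω μ ^ 2 : ℝ) : ℂ)) * bellMatrixᴴ := by
    rw [bellDiagonal_eq_conj_diagonal]
    calc _ = bellMatrix * (Matrix.diagonal fun μ => (ω μ : ℂ)) * (bellMatrixᴴ * bellMatrix) *
        (Matrix.diagonal fun μ => (ω μ : ℂ)) * bellMatrixᴴ := by simp only [Matrix.mul_assoc]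
      _ = _ := by
        rw [bellMatrix_conjTranspose_mul_self, Matrix.mul_one, Matrix.mul_assoc bellMatrix,
          Matrix.diagonal_mul_diagonal]
        simp [sq]
  rw [this, charpoly_conj_bellMatrix]
  have h := Polynomial.roots_multiset_prod_X_sub_C
    (Finset.univ.val.map fun μ : Fin 4 => ((ω μ ^ 2 : ℝ) : ℂ))
  rw [Multiset.map_map] at h
  exact h

/-- Conjugating the transpose by `σ` gives the adjugate, which is the inverse at determinant one. -/
theorem pauliThree_mul_transpose_mul {A : Matrix (Fin 2) (Fin 2) ℂ} (hA : A.det = 1) :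
    pauliThree * Aᵀ * pauliThree * A = 1 := by
  rw [Matrix.det_fin_two] at hA
  have ht : Aᵀ = !![A 0 0, A 1 0; A 0 1, A 1 1] := Matrix.eta_fin_two Aᵀ
  rw [ht]
  ext i j
  fin_cases i <;> fin_cases j <;>
    simp [pauliThree, Matrix.mul_apply, Fin.sum_univ_two] <;> grind [Complex.I_sq]

theorem spinFlip_kronecker_mul {A B : Matrix (Fin 2) (Fin 2) ℂ} (hA : A.det = 1) (hB : B.det = 1) :
    spinFlip (A ⊗ₖ B) * (A ⊗ₖ B) = 1 := by
  rw [spinFlip, ← Matrix.kroneckerMap_transpose]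
  simp only [← Matrix.mul_kronecker_mul, pauliThree_mul_transpose_mul hA,
    pauliThree_mul_transpose_mul hB, Matrix.one_kronecker_one]

theorem spinFlip_mul (M N : TwoQubitMatrix) : spinFlip (M * N) = spinFlip N * spinFlip M := by
  have h : (pauliThree ⊗ₖ pauliThree) * (pauliThree ⊗ₖ pauliThree) = 1 := by
    have : pauliThree * pauliThree = 1 := by
      ext i j
      fin_cases i <;> fin_cases j <;> simp [pauliThree, Matrix.mul_apply, Fin.sum_univ_two]
    rw [← Matrix.mul_kronecker_mul, this, Matrix.one_kronecker_one]
  simp only [spinFlip, Matrix.transpose_mul]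
  calc _ = (pauliThree ⊗ₖ pauliThree) * Nᵀ * 1 * Mᵀ * (pauliThree ⊗ₖ pauliThree) := by
        simp only [mul_one, mul_assoc]
    _ = _ := by rw [← h]; simp only [mul_assoc]

/-- The spin flip reverses products and inverts `M` and `M†`, so for `V = M W M†` the inner factors
cancel and `Ṽ V` is similar to `W̃ W`. -/
theorem LSLEquiv.charpoly_spinFlip_mul_eq {V W : Observable} (h : LSLEquiv W V) :
    (spinFlip (V : TwoQubitMatrix) * (V : TwoQubitMatrix)).charpoly =
      (spinFlip (W : TwoQubitMatrix) * (W : TwoQubitMatrix)).charpoly := by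
  obtain ⟨A, B, hA, hB, h⟩ := lslEquiv_iff.1 h
  have h1 := spinFlip_kronecker_mul hA hB
  have h2 : (A ⊗ₖ B)ᴴ * spinFlip (A ⊗ₖ B)ᴴ = 1 := by
    rw [mul_eq_one_comm, Matrix.conjTranspose_kronecker]
    exact spinFlip_kronecker_mul (by simp [Matrix.det_conjTranspose, hA])
      (by simp [Matrix.det_conjTranspose, hB])
  have e : spinFlip (V : TwoQubitMatrix) * (V : TwoQubitMatrix) =
      spinFlip (A ⊗ₖ B)ᴴ * (spinFlip (W : TwoQubitMatrix) * W * (A ⊗ₖ B)ᴴ) := by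
    rw [h, spinFlip_mul, spinFlip_mul]
    calc _ = spinFlip (A ⊗ₖ B)ᴴ * (spinFlip (W : TwoQubitMatrix) *
        (spinFlip (A ⊗ₖ B) * (A ⊗ₖ B)) * W * (A ⊗ₖ B)ᴴ) := by simp only [mul_assoc]
      _ = _ := by rw [h1, mul_one]
  rw [e, Matrix.charpoly_mul_comm, mul_assoc, h2, mul_one]

theorem IsProductPositive.add_pos {ω : Fin 4 → ℝ}
    (h : IsProductPositive (bellDiagonal ω : TwoQubitMatrix)) {μ ν : Fin 4} (hne : μ ≠ ν) :
    0 < ω μ + ω ν := by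
  have key : ∀ a b : Fin 2 → ℂ, a ≠ 0 → b ≠ 0 →
      0 < productExpectation (bellDiagonal ω)
        !![a 0 * star (a 0), a 0 * star (a 1); a 1 * star (a 0), a 1 * star (a 1)]
        !![b 0 * star (b 0), b 0 * star (b 1); b 1 * star (b 0), b 1 * star (b 1)] := by
    intro a b ha hb
    have := h _ _ (Matrix.posSemidef_vecMulVec_self_star a) (Matrix.posSemidef_vecMulVec_self_star b)
      (by simpa [Matrix.vecMulVec_eq_zero] using ha) (by simpa [Matrix.vecMulVec_eq_zero] using hb)
    rwa [Matrix.eta_fin_two (Matrix.vecMulVec a _), Matrix.eta_fin_two (Matrix.vecMulVec b _)] at this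
  -- Each of these six product vectors has equal overlap with two Bell states and is orthogonal to
  -- the other two, so it isolates one pairwise sum.
  have k01 := key ![1, 0] ![1, 0] (by simp) (by simp)
  have k23 := key ![1, 0] ![0, 1] (by simp) (by simp)
  have k02 := key ![1, 1] ![1, 1] (by simp) (by simp)
  have k13 := key ![1, 1] ![1, -1] (by simp) (by simp)
  have k03 := key ![1, Complex.I] ![1, -Complex.I] (by simp) (by simp)
  have k12 := key ![1, Complex.I] ![1, Complex.I] (by simp) (by simp)
  rw [bellDiagonal_eq] at k01 k23 k02 k13 k03 k12
  simp [productExpectation, Matrix.trace, Matrix.mul_apply, Fintype.sum_prod_type]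
    at k01 k23 k02 k13 k03 k12
  fin_cases μ <;> fin_cases ν <;> simp at hne ⊢ <;> linarith

/-! ### Uniqueness of the Bell-diagonal form -/

theorem exists_perm_antitone (ω : Fin 4 → ℝ) : ∃ π : Equiv.Perm (Fin 4), Antitone (ω ∘ π) :=
  ⟨Tuple.sort (-ω), fun i j h => by simpa using Tuple.monotone_sort (-ω) h⟩

theorem abs_le_of_add_pos {ω : Fin 4 → ℝ} (hω : Antitone ω)
    (hpos : ∀ μ ν, μ ≠ ν → 0 < ω μ + ω ν) : ω 2 ≥ |ω 3| :=
  abs_le.2 ⟨by linarith [hpos 2 3 (by decide)], hω (by decide)⟩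

/-- A decreasing quadruple with positive pairwise sums is determined by its product and the multiset
of its squares. -/
theorem eq_of_map_sq_eq {ω ω' : Fin 4 → ℝ} (hω : Antitone ω) (hω' : Antitone ω')
    (hpos : ∀ μ ν, μ ≠ ν → 0 < ω μ + ω ν) (hpos' : ∀ μ ν, μ ≠ ν → 0 < ω' μ + ω' ν)
    (hsq : Finset.univ.val.map (fun μ => ω μ ^ 2) = Finset.univ.val.map fun μ => ω' μ ^ 2)
    (hprod : ∏ μ, ω μ = ∏ μ, ω' μ) : ω = ω' := by
  -- Positive pairwise sums make squaring respect the order: `a ≥ b` and `a + b > 0` give `a² ≥ b²`.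
  -- Both lists of squares are thus sorted and agree entrywise.
  have anti : ∀ {ω : Fin 4 → ℝ}, Antitone ω → (∀ μ ν, μ ≠ ν → 0 < ω μ + ω ν) →
      Antitone fun μ => ω μ ^ 2 := by
    intro ω hω hpos μ ν h
    rcases h.eq_or_lt with rfl | hlt
    · exact le_rfl
    · have h1 := hω h
      have h2 := hpos μ ν hlt.ne
      show ω ν ^ 2 ≤ ω μ ^ 2
      nlinarith
  have hperm : (List.ofFn fun μ => ω μ ^ 2).Perm (List.ofFn fun μ => ω' μ ^ 2) := by
    rw [← Multiset.coe_eq_coe]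
    simpa [Fin.univ_val_map] using hsq
  have h := List.ofFn_injective (hperm.eq_of_sortedGE (anti hω hpos).sortedGE_ofFn
    (anti hω' hpos').sortedGE_ofFn)
  have nonneg : ∀ {ω : Fin 4 → ℝ}, Antitone ω → (∀ μ ν, μ ≠ ν → 0 < ω μ + ω ν) →
      ∀ μ, μ ≠ 3 → 0 < ω μ := by
    intro ω hω hpos μ hμ
    linarith [hpos μ 3 hμ, hω (show μ ≤ 3 from Fin.le_last μ)]
  have heq : ∀ μ, μ ≠ 3 → ω μ = ω' μ := fun μ hμ =>
    (pow_left_inj₀ (nonneg hω hpos μ hμ).le (nonneg hω' hpos' μ hμ).le two_ne_zero).1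
      (congrFun h μ)
  funext μ
  by_cases hμ : μ = 3
  · subst hμ
    -- The square leaves the sign of the last entry open; the product settles it, as the first three
    -- entries are positive.
    rw [Fin.prod_univ_four, Fin.prod_univ_four, heq 0 (by decide), heq 1 (by decide),
      heq 2 (by decide)] at hprod
    have := nonneg hω' hpos'
    exact mul_left_cancel₀ (mul_pos (mul_pos (this 0 (by decide)) (this 1 (by decide)))
      (this 2 (by decide))).ne' hprod
  · exact heq μ hμ

theorem LSLEquiv.roots_charpoly_eq {W : Observable} {ω : Fin 4 → ℝ}
    (h : LSLEquiv W (bellDiagonal ω)) :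
    (spinFlip (W : TwoQubitMatrix) * (W : TwoQubitMatrix)).charpoly.roots =
      Finset.univ.val.map (fun μ : Fin 4 => ((ω μ ^ 2 : ℝ) : ℂ)) := by
  rw [← h.charpoly_spinFlip_mul_eq, spinFlip_bellDiagonal, roots_charpoly_bellDiagonal_sq]

theorem eq_of_antitone_of_lslEquiv {W : Observable} (hW : IsProductPositive (W : TwoQubitMatrix))
    {ω ω' : Fin 4 → ℝ} (h : LSLEquiv W (bellDiagonal ω)) (h' : LSLEquiv W (bellDiagonal ω'))
    (hω : Antitone ω) (hω' : Antitone ω') : ω = ω' := by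
  refine eq_of_map_sq_eq hω hω' (fun _ _ => (hW.of_lslEquiv h).add_pos)
    (fun _ _ => (hW.of_lslEquiv h').add_pos) ?_ ?_
  · have := h.roots_charpoly_eq.symm.trans h'.roots_charpoly_eq
    refine Multiset.map_injective Complex.ofReal_injective ?_
    rw [Multiset.map_map, Multiset.map_map]
    exact this
  · have := h.det_eq.trans h'.det_eq.symm
    rw [det_bellDiagonal, det_bellDiagonal] at this
    exact Complex.ofReal_injective this

theorem exists_perm_of_lslEquiv {W : Observable} (hW : IsProductPositive (W : TwoQubitMatrix))
    {ω ω' : Fin 4 → ℝ} (h : LSLEquiv W (bellDiagonal ω)) (h' : LSLEquiv W (bellDiagonal ω')) :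
    ∃ π : Equiv.Perm (Fin 4), ω' = ω ∘ π := by
  obtain ⟨σ, hσ⟩ := exists_perm_antitone ω
  obtain ⟨τ, hτ⟩ := exists_perm_antitone ω'
  have e := eq_of_antitone_of_lslEquiv hW (h.trans (lslEquiv_bellDiagonal_perm ω σ))
    (h'.trans (lslEquiv_bellDiagonal_perm ω' τ)) hσ hτ
  refine ⟨σ * τ⁻¹, funext fun μ => ?_⟩
  simpa using (congrFun e (τ⁻¹ μ)).symm

theorem antitone_of_ordered {ω : Fin 4 → ℝ} (h : ω 0 ≥ ω 1 ∧ ω 1 ≥ ω 2 ∧ ω 2 ≥ |ω 3|) :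
    Antitone ω := by
  refine Fin.antitone_iff_succ_le.2 fun i => ?_
  fin_cases i
  · exact h.1
  · exact h.2.1
  · exact (le_abs_self _).trans h.2.2

theorem mainTheorem1 (W : Observable) (hW : W ∈ interior potentialWitnesses) :
    (∃ ω : Fin 4 → ℝ, LSLEquiv W (bellDiagonal ω)) ∧
    (∀ ω : Fin 4 → ℝ, LSLEquiv W (bellDiagonal ω) →
      bellDiagonal ω ∈ potentialWitnesses ∧
      (spinFlip (W : TwoQubitMatrix) * (W : TwoQubitMatrix)).charpoly.roots =
        Finset.univ.val.map (fun μ : Fin 4 => ((ω μ ^ 2 : ℝ) : ℂ)) ∧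
      (∀ ω' : Fin 4 → ℝ,
        LSLEquiv W (bellDiagonal ω') ↔ ∃ π : Equiv.Perm (Fin 4), ω' = ω ∘ π) ∧
      (∀ μ ν : Fin 4, ω μ < 0 → ω ν < 0 → μ = ν) ∧
      (∀ μ : Fin 4, ω μ < 0 → ∀ ν : Fin 4, ν ≠ μ → |ω μ| < |ω ν|)) ∧
    (∃! ω : Fin 4 → ℝ, LSLEquiv W (bellDiagonal ω) ∧
      ω 0 ≥ ω 1 ∧ ω 1 ≥ ω 2 ∧ ω 2 ≥ |ω 3|) := by
  have hpos := isProductPositive_of_mem_interior hW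
  obtain ⟨ω, hω⟩ := exists_lslEquiv_bellDiagonal hW
  refine ⟨⟨ω, hω⟩, fun ω hω => ⟨(hpos.of_lslEquiv hω).mem_potentialWitnesses,
    hω.roots_charpoly_eq, fun ω' => ⟨exists_perm_of_lslEquiv hpos hω, ?_⟩, ?_, ?_⟩, ?_⟩
  · rintro ⟨π, rfl⟩
    exact hω.trans (lslEquiv_bellDiagonal_perm ω π)
  · intro μ ν hμ hν
    by_contra hne
    linarith [(hpos.of_lslEquiv hω).add_pos hne]
  · intro μ hμ ν hne
    have := (hpos.of_lslEquiv hω).add_pos hne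
    rw [abs_of_neg hμ]
    exact (by linarith : -ω μ < ω ν).trans_le (le_abs_self _)
  · obtain ⟨π, hπ⟩ := exists_perm_antitone ω
    have h := hω.trans (lslEquiv_bellDiagonal_perm ω π)
    refine ⟨ω ∘ π, ⟨h, hπ (by decide), hπ (by decide),
      abs_le_of_add_pos hπ fun _ _ => (hpos.of_lslEquiv h).add_pos⟩, ?_⟩
    rintro ω' ⟨h', ho⟩
    exact eq_of_antitone_of_lslEquiv hpos h' h (antitone_of_ordered ho) hπ
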